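/- Let $M^n$ be a smooth Riemannian manifold (without boundary) with Levi-Civita connection $\bar\nabla$, and let $\Sigma\subset M$ be a hypersurface, possibly with singular points (any subset $\Sigma$ is allowed here). Suppose that $\Sigma$ is helicoidal in $M$, that is: $M\setminus\Sigma$ is the disjoint union of two domains (nonempty connected open sets) $D_1$ and $D_2$, and for every point $p\in\Sigma$ there is an isometry $\varphi$ of $M$ (a smooth diffeomorphism of $M$ preserving the Riemannian metric) with $$\varphi(p)=p,\qquad \varphi(\Sigma)=\Sigma,\qquad \varphi(D_1)=D_2,\qquad \varphi(D_2)=D_1 .$$ Then $\Sigma$ is minimal at every point where it is twice differentiable. Here $\Sigma$ is called twice differentiable at $p\in\Sigma$ if there are an open neighbourhood $U$ of $p$ and a $C^1$ function $f:U\to\mathbb R$ such that $\Sigma\cap U=\{f=0\}$, $df_p\neq 0$, and $df$ is differentiable at $p$ (in particular, this holds wherever $\Sigma$ is an embedded $C^2$ hypersurface). Minimal at $p$ means that the mean curvature vector $$\vec H(p)=\sum_{i=1}^{n-1}\bigl(\bar\nabla_{e_i}e_i\bigr)^{\perp}$$ is well defined and equal to $0$, where $e_1,\dots,e_{n-1}$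 are vector fields that are differentiable at $p$, tangent to $\Sigma$ along $\Sigma$ near $p$, and orthonormal at $p$, and $\perp$ denotes the component orthogonal to $T_p\Sigma$: such fields exist, and every choice of them gives $\vec H(p)=0$. -/

import Mathlib

open Bundle Set Filter VectorField
open scoped Manifold ContDiff Topology

noncomputable section

namespace Riemannian

/-! ### The Levi-Civita connection of a Riemannian manifold -/

section LeviCivita

variable {E : Type*} [NormedAddCommGroup E] [NormedSpace ℝ E]
  {H : Type*} [TopologicalSpace H] (I : ModelWithCorners ℝ E H)
  {M : Type*} [TopologicalSpace M] [ChartedSpace H M]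
  [RiemannianBundle (fun x : M ↦ TangentSpace I x)]

/-- The right-hand side of the Koszul formula: half of
`X⟨Y,Z⟩ + Y⟨X,Z⟩ - Z⟨X,Y⟩ + ⟨[X,Y],Z⟩ - ⟨[X,Z],Y⟩ - ⟨[Y,Z],X⟩` at the point `x`. -/
def koszul (X Y Z : Π x : M, TangentSpace I x) (x : M) : ℝ :=
  (d% (fun y : M ↦ inner ℝ (Y y) (Z y)) x (X x) + d% (fun y : M ↦ inner ℝ (X y) (Z y)) x (Y x)
    - d% (fun y : M ↦ inner ℝ (X y) (Y y)) x (Z x)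
    + inner ℝ (mlieBracket I X Y x) (Z x) - inner ℝ (mlieBracket I X Z x) (Y x)
    - inner ℝ (mlieBracket I Y Z x) (X x)) / 2

instance finiteDimensional_tangentSpace [FiniteDimensional ℝ E] (x : M) :
    FiniteDimensional ℝ (TangentSpace I x) :=
  inferInstanceAs (FiniteDimensional ℝ E)

variable [IsManifold I ∞ M] [IsContMDiffRiemannianBundle I ∞ E (fun x : M ↦ TangentSpace I x)]

variable {I} in
theorem mdiffAt_inner {X Y : Π x : M, TangentSpace I x} {x : M}
    (hX : MDiffAt (T% X) x) (hY : MDiffAt (T% Y) x) :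
    MDiffAt (fun y : M ↦ inner ℝ (X y) (Y y)) x :=
  MDifferentiableAt.inner_bundle (E := fun x : M ↦ TangentSpace I x) (F := E) hX hY

variable [FiniteDimensional ℝ E]

theorem koszul_tensorial₁ {Y Z : Π x : M, TangentSpace I x} {x : M}
    (hY : MDiffAt (T% Y) x) (hZ : MDiffAt (T% Z) x) :
    TensorialAt I E (fun X ↦ koszul I X Y Z x) x where
  smul {f X} hf hX := by
    have h1 := mvfderiv_fun_mul hf (mdiffAt_inner hX hZ)
    have h2 := mvfderiv_fun_mul hf (mdiffAt_inner hX hY)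
    simp only [koszul, Pi.smul_apply', real_inner_smul_left, real_inner_smul_right, h1, h2,
      mlieBracket_smul_left hf hX, map_smul, inner_add_left]
    simp
    ring
  add {X X'} hX hX' := by
    have h1 := mvfderiv_fun_add (mdiffAt_inner hX hZ) (mdiffAt_inner hX' hZ)
    have h2 := mvfderiv_fun_add (mdiffAt_inner hX hY) (mdiffAt_inner hX' hY)
    simp only [koszul, Pi.add_apply, h1, h2, mlieBracket_add_left hX hX', map_add,
      inner_add_left, inner_add_right]
    simp
    ring

theorem koszul_add₂ {X Y Y' Z : Π x : M, TangentSpace I x} {x : M}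
    (hX : MDiffAt (T% X) x) (hY : MDiffAt (T% Y) x) (hY' : MDiffAt (T% Y') x)
    (hZ : MDiffAt (T% Z) x) :
    koszul I X (Y + Y') Z x = koszul I X Y Z x + koszul I X Y' Z x := by
  have h1 := mvfderiv_fun_add (mdiffAt_inner hY hZ) (mdiffAt_inner hY' hZ)
  have h2 := mvfderiv_fun_add (mdiffAt_inner hX hY) (mdiffAt_inner hX hY')
  simp only [koszul, Pi.add_apply, h1, h2, mlieBracket_add_left hY hY',
    mlieBracket_add_right hY hY', map_add, inner_add_left, inner_add_right]
  simp
  ring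

theorem koszul_smul₂ {X Y Z : Π x : M, TangentSpace I x} {f : M → ℝ} {x : M}
    (hX : MDiffAt (T% X) x) (hY : MDiffAt (T% Y) x) (hZ : MDiffAt (T% Z) x) (hf : MDiffAt f x) :
    koszul I X (f • Y) Z x = f x * koszul I X Y Z x + d% f x (X x) * inner ℝ (Y x) (Z x) := by
  have h1 := mvfderiv_fun_mul hf (mdiffAt_inner hY hZ)
  have h2 := mvfderiv_fun_mul hf (mdiffAt_inner hX hY)
  simp only [koszul, Pi.smul_apply', real_inner_smul_left, real_inner_smul_right, h1, h2,
    mlieBracket_smul_left hf hY, mlieBracket_smul_right hf hY, map_smul, inner_add_left]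
  simp
  rw [real_inner_comm (X x) (Y x)]
  ring

theorem koszul_tensorial₃ {X Y : Π x : M, TangentSpace I x} {x : M}
    (hX : MDiffAt (T% X) x) (hY : MDiffAt (T% Y) x) :
    TensorialAt I E (fun Z ↦ koszul I X Y Z x) x where
  smul {f Z} hf hZ := by
    have h1 := mvfderiv_fun_mul hf (mdiffAt_inner hY hZ)
    have h2 := mvfderiv_fun_mul hf (mdiffAt_inner hX hZ)
    simp only [koszul, Pi.smul_apply', real_inner_smul_left, real_inner_smul_right, h1, h2,
      mlieBracket_smul_right hf hZ, map_smul, inner_add_left]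
    simp
    rw [real_inner_comm (Z x) (Y x), real_inner_comm (Z x) (X x)]
    ring
  add {Z Z'} hZ hZ' := by
    have h1 := mvfderiv_fun_add (mdiffAt_inner hY hZ) (mdiffAt_inner hY hZ')
    have h2 := mvfderiv_fun_add (mdiffAt_inner hX hZ) (mdiffAt_inner hX hZ')
    simp only [koszul, Pi.add_apply, h1, h2, mlieBracket_add_right hZ hZ', map_add,
      inner_add_left, inner_add_right]
    simp
    ring

open Classical in
/-- The Levi-Civita connection as a bare function: for a vector field `Y` differentiable at `x`,
`leviCivitaFun I Y x u` is the vector `∇_u Y` at `x` determined by the Koszul formula. -/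
def leviCivitaFun (Y : Π x : M, TangentSpace I x) (x : M) :
    TangentSpace I x →L[ℝ] TangentSpace I x :=
  if hY : MDiffAt (T% Y) x then
    let B : TangentSpace I x →L[ℝ] TangentSpace I x →L[ℝ] ℝ :=
      TensorialAt.mkHom₂ (fun X Z ↦ koszul I X Y Z x) x
        (fun _ hZ ↦ koszul_tensorial₁ I hY hZ) (fun _ hX ↦ koszul_tensorial₃ I hX hY)
    LinearMap.toContinuousLinearMap
      { toFun := fun u ↦ (InnerProductSpace.toDual ℝ (TangentSpace I x)).symm (B u)
        map_add' := fun u v ↦ by simp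
        map_smul' := fun c u ↦ by simp }
  else 0

variable {I} in
theorem inner_leviCivitaFun {X Y Z : Π x : M, TangentSpace I x} {x : M}
    (hX : MDiffAt (T% X) x) (hY : MDiffAt (T% Y) x) (hZ : MDiffAt (T% Z) x) :
    inner ℝ (leviCivitaFun I Y x (X x)) (Z x) = koszul I X Y Z x := by
  have h := TensorialAt.mkHom₂_apply (Φ := fun X Z ↦ koszul I X Y Z x) (x := x)
    (fun _ hZ ↦ koszul_tensorial₁ I hY hZ) (fun _ hX ↦ koszul_tensorial₃ I hX hY) hX hZ
  rw [← h]
  simp only [leviCivitaFun, hY, dif_pos]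
  exact InnerProductSpace.toDual_symm_apply

variable (M) in
/-- The Levi-Civita connection of a Riemannian manifold `M`;
`leviCivita I M Y x u` is `∇_u Y` at the point `x`. -/
def leviCivita : CovariantDerivative I E (fun x : M ↦ TangentSpace I x) where
  toFun := leviCivitaFun I
  isCovariantDerivativeOnUniv :=
    { add := fun {Y Y' x} hY hY' _ ↦ by
        ext1 u
        refine ext_inner_right ℝ fun w ↦ ?_
        have hX := FiberBundle.mdifferentiableAt_extend I E u
        have hZ := FiberBundle.mdifferentiableAt_extend I E w
        have hs := mdifferentiableAt_add_section hY hY'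
        have h0 := inner_leviCivitaFun hX hs hZ
        have h1 := inner_leviCivitaFun hX hY hZ
        have h2 := inner_leviCivitaFun hX hY' hZ
        have h3 := koszul_add₂ I hX hY hY' hZ
        simp only [FiberBundle.extend_apply_self] at h0 h1 h2
        rw [add_apply, inner_add_left, h1, h2, ← h3]
        exact h0
      leibniz := fun {Y f x} hY hf _ ↦ by
        ext1 u
        refine ext_inner_right ℝ fun w ↦ ?_
        have hX := FiberBundle.mdifferentiableAt_extend I E u
        have hZ := FiberBundle.mdifferentiableAt_extend I E w
        have hs := hf.smul_section hY
        have h0 := inner_leviCivitaFun hX hs hZ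
        have h1 := inner_leviCivitaFun hX hY hZ
        have h3 := koszul_smul₂ I hX hY hZ hf
        simp only [FiberBundle.extend_apply_self] at h0 h1 h3
        simp only [add_apply, smul_apply,
          ContinuousLinearMap.smulRight_apply, inner_add_left, real_inner_smul_left, h1]
        rw [← h3]
        exact h0 }

/-- The Levi-Civita connection is compatible with the metric. -/
theorem leviCivita_metric {X Y Z : Π x : M, TangentSpace I x} {x : M}
    (hX : MDiffAt (T% X) x) (hY : MDiffAt (T% Y) x) (hZ : MDiffAt (T% Z) x) :
    d% (fun y : M ↦ inner ℝ (Y y) (Z y)) x (X x) =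
      inner ℝ (leviCivita I M Y x (X x)) (Z x) + inner ℝ (Y x) (leviCivita I M Z x (X x)) := by
  have h1 := inner_leviCivitaFun hX hY hZ
  have h2 := inner_leviCivitaFun hX hZ hY
  rw [real_inner_comm] at h2
  change _ = inner ℝ (leviCivitaFun I Y x (X x)) (Z x) + inner ℝ (Y x) (leviCivitaFun I Z x (X x))
  rw [h1, h2]
  have h4 : mlieBracket I Z Y x = - mlieBracket I Y Z x := mlieBracket_swap_apply
  have h5 : (fun y : M ↦ inner ℝ (Z y) (Y y)) = fun y : M ↦ inner ℝ (Y y) (Z y) := by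
    ext y; exact real_inner_comm _ _
  simp only [koszul, h4, h5, inner_neg_left]
  ring

/-- The Levi-Civita connection is torsion-free. -/
theorem leviCivita_torsion : (leviCivita I M).torsion = 0 := by
  rw [CovariantDerivative.torsion_eq_zero_iff]
  intro X Y x hX hY
  refine ext_inner_right ℝ fun w ↦ ?_
  have hZ := FiberBundle.mdifferentiableAt_extend I E w
  have h1 := inner_leviCivitaFun hX hY hZ
  have h2 := inner_leviCivitaFun hY hX hZ
  simp only [FiberBundle.extend_apply_self] at h1 h2
  change inner ℝ (leviCivitaFun I Y x (X x) - leviCivitaFun I X x (Y x)) w = _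
  rw [inner_sub_left, h1, h2]
  have h4 : mlieBracket I Y X x = - mlieBracket I X Y x := mlieBracket_swap_apply
  have h5 : (fun y : M ↦ inner ℝ (Y y) (X y)) = fun y : M ↦ inner ℝ (X y) (Y y) := by
    ext y; exact real_inner_comm _ _
  simp only [koszul, h4, h5, inner_neg_left, FiberBundle.extend_apply_self]
  ring

end LeviCivita

/-! ### Hypersurfaces, mean curvature, helicoidal hypersurfaces

A hypersurface, possibly with singular points, is treated as a subset `S` of `M`. -/

section Hypersurface

variable {n : ℕ} {M : Type*} [TopologicalSpace M] [ChartedSpace (EuclideanSpace ℝ (Fin n)) M]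

/-- The tangent space `T_q S ⊆ T_q M` of a subset `S` of `M`: the span of the velocities at `q` of
the curves that run in `S`. -/
def tangentSpaceOf (S : Set M) (q : M) : Submodule ℝ (TangentSpace (𝓡 n) q) :=
  Submodule.span ℝ {v | ∃ γ : ℝ → M, (∀ᶠ t in 𝓝 0, γ t ∈ S) ∧
    MDifferentiableAt 𝓘(ℝ, ℝ) (𝓡 n) γ 0 ∧
    tangentMap 𝓘(ℝ, ℝ) (𝓡 n) γ ⟨0, (1 : ℝ)⟩ = (⟨q, v⟩ : TangentBundle (𝓡 n) M)}

/-- `S` is, near its point `p`, an embedded hypersurface that is twice differentiable at `p`: on a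
neighbourhood of `p` it is the zero set of a `C¹` function whose differential does not vanish at
`p` and is differentiable at `p` (in the chart at `p`). -/
def IsTwiceDifferentiableHypersurfaceAt (S : Set M) (p : M) : Prop :=
  ∃ (U : Set M) (f : M → ℝ), IsOpen U ∧ p ∈ U ∧ S ∩ U = {x ∈ U | f x = 0} ∧
    f p = 0 ∧ ContMDiffOn (𝓡 n) 𝓘(ℝ, ℝ) 1 f U ∧ mfderiv (𝓡 n) 𝓘(ℝ, ℝ) f p ≠ 0 ∧
    DifferentiableAt ℝ (fderiv ℝ (f ∘ (extChartAt (𝓡 n) p).symm)) (extChartAt (𝓡 n) p p)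

/-- `S` divides `M` into the two domains `D₁` and `D₂`. -/
structure Divides (S D₁ D₂ : Set M) : Prop where
  isOpen₁ : IsOpen D₁
  isOpen₂ : IsOpen D₂
  isConnected₁ : IsConnected D₁
  isConnected₂ : IsConnected D₂
  disjoint : Disjoint D₁ D₂
  union_eq : D₁ ∪ D₂ = Sᶜ

variable [RiemannianBundle (fun x : M ↦ TangentSpace (𝓡 n) x)]

/-- A diffeomorphism of `M` that preserves the Riemannian metric. -/
def IsRiemannianIsometry (φ : M ≃ₘ^∞⟮𝓡 n, 𝓡 n⟯ M) : Prop :=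
  ∀ (x : M) (v w : TangentSpace (𝓡 n) x),
    inner ℝ (mfderiv (𝓡 n) (𝓡 n) φ x v) (mfderiv (𝓡 n) (𝓡 n) φ x w) = inner ℝ v w

variable (n) in
/-- `S` divides `M` into two domains, and every point of `S` is fixed by an isometry of `M` that
preserves `S` and swaps the two domains. -/
def IsHelicoidal (S : Set M) : Prop :=
  ∃ D₁ D₂ : Set M, Divides S D₁ D₂ ∧ ∀ p ∈ S, ∃ φ : M ≃ₘ^∞⟮𝓡 n, 𝓡 n⟯ M,
    IsRiemannianIsometry φ ∧ φ p = p ∧ φ '' S = S ∧ φ '' D₁ = D₂ ∧ φ '' D₂ = D₁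

variable [IsManifold (𝓡 n) ∞ M]
  [IsContMDiffRiemannianBundle (𝓡 n) ∞ (EuclideanSpace ℝ (Fin n))
    (fun x : M ↦ TangentSpace (𝓡 n) x)]

/-- `H` is the mean curvature vector of `S` at `p`: it is the component orthogonal to `T_p S` of
`∑ i, ∇_{e i} (e i)`, where `e 1, …, e (n - 1)` are vector fields, differentiable at `p` and tangent
to `S` along `S` near `p`, that are orthonormal at `p`. -/
def HasMeanCurvatureVectorAt (S : Set M) (p : M) (H : TangentSpace (𝓡 n) p) : Prop :=
  ∃ e : Fin (n - 1) → Π x : M, TangentSpace (𝓡 n) x,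
    (∀ i, MDifferentiableAt (𝓡 n) (𝓡 n).tangent
      (fun x : M ↦ (⟨x, e i x⟩ : TangentBundle (𝓡 n) M)) p) ∧
    (∀ i, ∀ᶠ q in 𝓝[S] p, e i q ∈ tangentSpaceOf S q) ∧
    Orthonormal ℝ (fun i ↦ e i p) ∧
    (∑ i, leviCivita (𝓡 n) M (e i) p (e i p)) - H ∈ tangentSpaceOf S p ∧
    ∀ v ∈ tangentSpaceOf S p, inner ℝ H v = 0

variable (n) in
/-- `S` is minimal at `p`: its mean curvature vector at `p` exists, is unique, and vanishes. -/
def IsMinimalAt (S : Set M) (p : M) : Prop :=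
  ∀ H : TangentSpace (𝓡 n) p, HasMeanCurvatureVectorAt S p H ↔ H = 0

end Hypersurface

end Riemannian

end

noncomputable section

namespace Riemannian

/-! ### Level sets of a real function near a regular point -/

section LevelSet

variable {E : Type*} [NormedAddCommGroup E] [NormedSpace ℝ E] [FiniteDimensional ℝ E]

/-! Let `f` be the defining function near `p`, so that `T_p S = ker df_p`. Minimality at `p` says
that `s(e) = ∑ i, (∇_{e i} (e i)) f` vanishes at `p` for tangent frames `e`, together with the
existence of such a frame.

The number `s(e)` does not depend on the frame. Since `(e i) f` vanishes along `S`, its derivative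
in the tangent direction `e i p` is zero. Hence `s(e)` is minus the trace over `ker df_p` of the
Hessian `u (Y f) - (∇_u Y) f`, and a trace is the same in all orthonormal bases
(`sum_mvfderiv_leviCivita_eq`). This uses neither symmetry of the Hessian nor more than
differentiability of `df` at `p`.

Now let `φ` be the isometry at `p`. It preserves `S`, so `f ∘ φ` vanishes on `S` as well and `d(f ∘
φ)_p = c • df_p`. As `φ` swaps the two domains, `c ≤ 0` (`mvfderiv_mfderiv_nonpos_of_swap`):
otherwise some point and its image would lie on the same connected side of `S`. The pulled-back
frame is again a tangent frame, and naturality of the connection (`mfderiv_leviCivita_mpullback`)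
gives `s(e) = c * s(φ^* e)`. By independence of the frame `s = c * s`, and `c ≤ 0` forces `s = 0`.
The exact value of `c` is never needed. -/

theorem range_eq_top_of_ne_zero {E : Type*} [NormedAddCommGroup E] [NormedSpace ℝ E]
    {F' : E →L[ℝ] ℝ} (h : F' ≠ 0) : F'.range = ⊤ := by
  rw [LinearMap.range_eq_top]
  exact LinearMap.surjective (fun h0 ↦ h (ContinuousLinearMap.coe_injective h0))

/-- Every vector in the kernel of the derivative is the velocity of a curve in the level set. -/
theorem exists_hasDerivAt_levelSet {F : E → ℝ} {F' : E →L[ℝ] ℝ} {a v : E}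
    (hF : HasStrictFDerivAt F F' a) (h0 : F' ≠ 0) (hv : F' v = 0) :
    ∃ γ : ℝ → E, γ 0 = a ∧ HasDerivAt γ v 0 ∧ ∀ᶠ t in 𝓝 (0 : ℝ), F (γ t) = F a := by
  have : CompleteSpace E := FiniteDimensional.complete ℝ E
  have hr := range_eq_top_of_ne_zero h0
  let w : F'.ker := ⟨v, hv⟩
  have hc : Continuous fun t : ℝ ↦ t • w := by fun_prop
  -- The implicit function parametrizes the level set by `ker F'`, with the inclusion as derivative
  -- at `0`; the curve is the image of the line `t • w`.
  refine ⟨fun t ↦ hF.implicitFunction F F' hr (F a) (t • w), by simp, ?_, ?_⟩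
  · have h1 := (hF.to_implicitFunction hr).hasFDerivAt
    have h2 : HasDerivAt (fun t : ℝ ↦ t • w) w 0 := by
      simpa using (hasDerivAt_id (0 : ℝ)).smul_const w
    have h3 : HasFDerivAt (hF.implicitFunction F F' hr (F a)) F'.ker.subtypeL ((0 : ℝ) • w) := by
      rwa [zero_smul]
    exact h3.comp_hasDerivAt 0 h2
  · have h1 := hF.map_implicitFunction_eq hr
    have h2 : Tendsto (fun t : ℝ ↦ (F a, t • w)) (𝓝 0) (𝓝 (F a, 0)) := by
      have : Continuous fun t : ℝ ↦ (F a, t • w) := by fun_prop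
      simpa using this.tendsto 0
    exact h2.eventually h1

/-- Near a regular zero, the positive side of the zero set is connected. -/
theorem exists_isPreconnected_pos {F : E → ℝ} {F' : E →L[ℝ] ℝ} {a : E} {N : Set E}
    (hF : HasStrictFDerivAt F F' a) (h0 : F' ≠ 0) (hN : N ∈ 𝓝 a) :
    ∃ W : Set E, IsPreconnected W ∧ W ⊆ N ∧ (∀ x ∈ W, 0 < F x) ∧
      ∀ᶠ x in 𝓝 a, 0 < F x → x ∈ W := by
  have : CompleteSpace E := FiniteDimensional.complete ℝ E
  have hr := range_eq_top_of_ne_zero h0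
  let Ψ := hF.implicitToOpenPartialHomeomorph F F' hr
  have hs : a ∈ Ψ.source := hF.mem_implicitToOpenPartialHomeomorph_source hr
  have hΨ : ∀ x, (Ψ x).1 = F x := fun x ↦ hF.implicitToOpenPartialHomeomorph_fst hr x
  have ht : Ψ.target ∩ Ψ.symm ⁻¹' N ∈ 𝓝 (Ψ a) := by
    refine inter_mem (Ψ.open_target.mem_nhds (Ψ.map_source hs)) ?_
    refine (Ψ.continuousAt_symm (Ψ.map_source hs)).preimage_mem_nhds ?_
    rwa [Ψ.left_inv hs]
  obtain ⟨r, hr0, hball⟩ := Metric.mem_nhds_iff.1 ht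
  -- In the straightened coordinates `F` is the first component, so its positive side in a ball is a
  -- half-ball, which is convex.
  have hconv : Convex ℝ (Metric.ball (Ψ a) r ∩ {y | 0 < y.1}) :=
    (convex_ball _ _).inter (convex_halfSpace_gt (LinearMap.fst ℝ ℝ F'.ker).isLinear 0)
  refine ⟨Ψ.symm '' (Metric.ball (Ψ a) r ∩ {y | 0 < y.1}), ?_, ?_, ?_, ?_⟩
  · refine hconv.isPreconnected.image _ (Ψ.continuousOn_symm.mono ?_)
    exact fun y hy ↦ (hball hy.1).1
  · rintro _ ⟨y, hy, rfl⟩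
    exact (hball hy.1).2
  · rintro _ ⟨y, hy, rfl⟩
    rw [← hΨ, Ψ.right_inv (hball hy.1).1]
    exact hy.2
  · have h1 : ∀ᶠ x in 𝓝 a, Ψ x ∈ Metric.ball (Ψ a) r :=
      (Ψ.continuousAt hs).preimage_mem_nhds (Metric.ball_mem_nhds _ hr0)
    filter_upwards [h1, Ψ.open_source.mem_nhds hs] with x hx hxs hpos
    exact ⟨Ψ x, ⟨hx, by simpa [hΨ] using hpos⟩, Ψ.left_inv hxs⟩

end LevelSet

/-! ### Isometries preserve the Levi-Civita connection -/

section Naturality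

variable {E : Type*} [NormedAddCommGroup E] [NormedSpace ℝ E]
  {H : Type*} [TopologicalSpace H] {I : ModelWithCorners ℝ E H}
  {M : Type*} [TopologicalSpace M] [ChartedSpace H M] [IsManifold I ∞ M]

omit [IsManifold I ∞ M] in
theorem isInvertible_mfderiv (φ : M ≃ₘ^∞⟮I, I⟯ M) (x : M) :
    (mfderiv I I φ x).IsInvertible :=
  ⟨φ.mfderivToContinuousLinearEquiv (by simp) x, rfl⟩

omit [IsManifold I ∞ M] in
theorem mfderiv_mpullback (φ : M ≃ₘ^∞⟮I, I⟯ M) (V : Π x : M, TangentSpace I x) (x : M) :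
    mfderiv I I φ x (mpullback I I φ V x) = V (φ x) :=
  (isInvertible_mfderiv φ x).self_apply_inverse _

variable [FiniteDimensional ℝ E] in
theorem mdifferentiableAt_mpullback (φ : M ≃ₘ^∞⟮I, I⟯ M)
    {V : Π x : M, TangentSpace I x} {x : M} (hV : MDiffAt (T% V) (φ x)) :
    MDiffAt (T% (mpullback I I φ V)) x :=
  -- The pullback involves the inverse of `dφ`, so `φ` must have one more degree of smoothness than
  -- the pulled-back field.
  hV.mpullback_vectorField (n := 2) ((φ.contMDiff x).of_le ENat.LEInfty.out)
    (isInvertible_mfderiv φ x) le_rfl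

variable [RiemannianBundle (fun x : M ↦ TangentSpace I x)]

omit [IsManifold I ∞ M] in
theorem inner_mpullback {φ : M ≃ₘ^∞⟮I, I⟯ M}
    (hφ : ∀ (x : M) (v w : TangentSpace I x),
      inner ℝ (mfderiv I I φ x v) (mfderiv I I φ x w) = inner ℝ v w)
    (V W : Π x : M, TangentSpace I x) (x : M) :
    inner ℝ (mpullback I I φ V x) (mpullback I I φ W x) =
      inner ℝ (V (φ x)) (W (φ x)) := by
  rw [← hφ, mfderiv_mpullback, mfderiv_mpullback]

variable [FiniteDimensional ℝ E] [IsContMDiffRiemannianBundle I ∞ E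
      (fun x : M ↦ TangentSpace I x)]

omit [FiniteDimensional ℝ E] in
theorem mvfderiv_inner_mpullback {φ : M ≃ₘ^∞⟮I, I⟯ M}
    (hφ : ∀ (x : M) (v w : TangentSpace I x),
      inner ℝ (mfderiv I I φ x v) (mfderiv I I φ x w) = inner ℝ v w)
    {X Y Z : Π x : M, TangentSpace I x} {x : M}
    (hY : MDiffAt (T% Y) (φ x)) (hZ : MDiffAt (T% Z) (φ x)) :
    mvfderiv I (fun y : M ↦ (inner ℝ (mpullback I I φ Y y)
      (mpullback I I φ Z y) : ℝ)) x (mpullback I I φ X x) =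
      mvfderiv I (fun y : M ↦ (inner ℝ (Y y) (Z y) : ℝ)) (φ x) (X (φ x)) := by
  have h : (fun y : M ↦ (inner ℝ (mpullback I I φ Y y)
      (mpullback I I φ Z y) : ℝ)) = (fun y : M ↦ (inner ℝ (Y y) (Z y) : ℝ)) ∘ φ :=
    funext fun y ↦ inner_mpullback hφ Y Z y
  rw [h, mvfderiv_comp_apply x (mdiffAt_inner hY hZ) (φ.mdifferentiable (by simp) x),
    mfderiv_mpullback]

/-- The Koszul expression is built only from inner products, their derivatives and Lie brackets,
each of which commutes with pullback along an isometry. -/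
theorem koszul_mpullback {φ : M ≃ₘ^∞⟮I, I⟯ M}
    (hφ : ∀ (x : M) (v w : TangentSpace I x),
      inner ℝ (mfderiv I I φ x v) (mfderiv I I φ x w) = inner ℝ v w)
    {X Y Z : Π x : M, TangentSpace I x} {x : M}
    (hX : MDiffAt (T% X) (φ x)) (hY : MDiffAt (T% Y) (φ x)) (hZ : MDiffAt (T% Z) (φ x)) :
    koszul I (mpullback I I φ X) (mpullback I I φ Y)
      (mpullback I I φ Z) x = koszul I X Y Z (φ x) := by
  have : IsManifold I (minSmoothness ℝ 2) M :=
    .of_le (n := ∞) (by simpa using ENat.LEInfty.out)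
  have : IsManifold I (minSmoothness ℝ 3) M :=
    .of_le (n := ∞) (by simpa using ENat.LEInfty.out)
  have : CompleteSpace E := FiniteDimensional.complete ℝ E
  have hb : ∀ {V W : Π x : M, TangentSpace I x}, MDiffAt (T% V) (φ x) →
      MDiffAt (T% W) (φ x) →
      mlieBracket I (mpullback I I φ V) (mpullback I I φ W) x =
      mpullback I I φ (mlieBracket I V W) x := fun hV hW ↦
    (mpullback_mlieBracket (n := 2) hV hW ((φ.contMDiff x).of_le ENat.LEInfty.out)
      (by simp)).symm
  rw [koszul, mvfderiv_inner_mpullback hφ hY hZ, mvfderiv_inner_mpullback hφ hX hZ,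
    mvfderiv_inner_mpullback hφ hX hY]
  simp only [koszul, hb hX hY, hb hX hZ, hb hY hZ, inner_mpullback hφ]

/-- Isometries preserve the Levi-Civita connection. -/
theorem mfderiv_leviCivita_mpullback {φ : M ≃ₘ^∞⟮I, I⟯ M}
    (hφ : ∀ (x : M) (v w : TangentSpace I x),
      inner ℝ (mfderiv I I φ x v) (mfderiv I I φ x w) = inner ℝ v w)
    {X Y : Π x : M, TangentSpace I x} {x : M}
    (hX : MDiffAt (T% X) (φ x)) (hY : MDiffAt (T% Y) (φ x)) :
    mfderiv I I φ x (leviCivita I M (mpullback I I φ Y) x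
      (mpullback I I φ X x)) = leviCivita I M Y (φ x) (X (φ x)) := by
  -- The metric is nondegenerate, so it suffices to test against each `w`; extending `w` to a field
  -- turns both sides into Koszul expressions.
  refine ext_inner_right ℝ fun w ↦ ?_
  have hZ := FiberBundle.mdifferentiableAt_extend I E w
  set Z := FiberBundle.extend E w
  have hw : Z (φ x) = w := by simp [Z]
  have h1 := inner_leviCivitaFun (mdifferentiableAt_mpullback φ hX)
    (mdifferentiableAt_mpullback φ hY) (mdifferentiableAt_mpullback φ hZ)
  have h2 := inner_leviCivitaFun hX hY hZ
  rw [koszul_mpullback hφ hX hY hZ, ← h2, ← hφ, mfderiv_mpullback, hw] at h1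
  exact h1

end Naturality

/-! ### The Hessian and its trace -/

section Trace

variable {V : Type*} [NormedAddCommGroup V] [InnerProductSpace ℝ V] [FiniteDimensional ℝ V]

/-- The trace of a bilinear form on a subspace, computed in two orthonormal bases. -/
theorem sum_bilin_orthonormal_eq {ι : Type*} [Fintype ι] {K : Submodule ℝ V}
    (hK : Fintype.card ι = Module.finrank ℝ K) (B : V →ₗ[ℝ] V →ₗ[ℝ] ℝ) {v w : ι → V}
    (hv : Orthonormal ℝ v) (hvK : ∀ i, v i ∈ K) (hw : Orthonormal ℝ w) (hwK : ∀ i, w i ∈ K) :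
    ∑ i, B (v i) (v i) = ∑ i, B (w i) (w i) := by
  -- `T` represents `B` on `K` through the Riesz isomorphism; both sums equal its trace. No symmetry
  -- of `B` is required.
  let T : K →ₗ[ℝ] K := (InnerProductSpace.toDual ℝ K).symm.toLinearEquiv.toLinearMap ∘ₗ
    LinearMap.toContinuousLinearMap.toLinearMap ∘ₗ (B.domRestrict₁₂ K K)
  have hT : ∀ a b : K, inner ℝ b (T a) = B a b := fun a b ↦ by
    rw [real_inner_comm]
    exact InnerProductSpace.toDual_symm_apply
  have key : ∀ u : ι → V, Orthonormal ℝ u → (∀ i, u i ∈ K) →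
      ∑ i, B (u i) (u i) = T.trace ℝ K := fun u hu huK ↦ by
    have ho := hu.codRestrict K huK
    have hspan : ⊤ ≤ Submodule.span ℝ (Set.range (Set.codRestrict u K huK)) :=
      (ho.linearIndependent.span_eq_top_of_card_eq_finrank' hK).ge
    rw [LinearMap.trace_eq_sum_inner T (OrthonormalBasis.mk ho hspan)]
    refine Finset.sum_congr rfl fun i _ ↦ ?_
    rw [hT]
    simp
  rw [key v hv hvK, key w hw hwK]

end Trace

section Hessian

variable {E : Type*} [NormedAddCommGroup E] [NormedSpace ℝ E] [FiniteDimensional ℝ E]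
  {H : Type*} [TopologicalSpace H] {I : ModelWithCorners ℝ E H}
  {M : Type*} [TopologicalSpace M] [ChartedSpace H M]
  [RiemannianBundle (fun x : M ↦ TangentSpace I x)]
  [IsManifold I ∞ M] [IsContMDiffRiemannianBundle I ∞ E (fun x : M ↦ TangentSpace I x)]

variable (I) in
/-- The Hessian `u (Y f) - (∇_u Y) f` of a function `f` at the point `p`. -/
def hessian (f : M → ℝ) (p : M) (u : TangentSpace I p) (Y : Π x : M, TangentSpace I x) : ℝ :=
  mvfderiv I (fun q : M ↦ mvfderiv I f q (Y q)) p u - mvfderiv I f p (leviCivita I M Y p u)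

variable {f : M → ℝ} {p : M}

/-- Replacing `Y` by `g • Y` adds `(u g) (Y f)` to both terms, and these cancel. The second-order
regularity of `f` enters only through differentiability at `p` of the functions `Y f`. -/
theorem hessian_tensorialAt
    (hf : ∀ Y : Π x : M, TangentSpace I x, MDiffAt (T% Y) p →
      MDiffAt (fun q : M ↦ mvfderiv I f q (Y q)) p) (u : TangentSpace I p) :
    TensorialAt I E (hessian I f p u) p where
  smul {g Y} hg hY := by
    have h1 := mvfderiv_fun_mul hg (hf Y hY)
    have h2 := (leviCivita I M).isCovariantDerivativeOnUniv.leibniz hY hg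
    simp only [hessian, Pi.smul_apply', map_smul, smul_eq_mul, h1, h2]
    simp
    ring
  add {Y Y'} hY hY' := by
    have h1 := mvfderiv_fun_add (hf Y hY) (hf Y' hY')
    have h2 := (leviCivita I M).isCovariantDerivativeOnUniv.add hY hY'
    simp only [hessian, Pi.add_apply, map_add, h1, h2]
    simp
    ring

/-- For a frame `e` that is orthonormal at `p`, tangent at `p` to the level set of `f`, and along
which the derivatives `(e i) f` are stationary, `∑ i, (∇_{e i} (e i)) f` is independent of `e`. -/
theorem sum_mvfderiv_leviCivita_eq {ι : Type*} [Fintype ι]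
    (hf : ∀ Y : Π x : M, TangentSpace I x, MDiffAt (T% Y) p →
      MDiffAt (fun q : M ↦ mvfderiv I f q (Y q)) p)
    (hι : Fintype.card ι = Module.finrank ℝ (mvfderiv I f p).ker)
    {e e' : ι → Π x : M, TangentSpace I x}
    (he : ∀ i, MDiffAt (T% (e i)) p) (he' : ∀ i, MDiffAt (T% (e' i)) p)
    (ho : Orthonormal ℝ fun i ↦ e i p) (ho' : Orthonormal ℝ fun i ↦ e' i p)
    (hk : ∀ i, mvfderiv I f p (e i p) = 0) (hk' : ∀ i, mvfderiv I f p (e' i p) = 0)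
    (hd : ∀ i, mvfderiv I (fun q : M ↦ mvfderiv I f q (e i q)) p (e i p) = 0)
    (hd' : ∀ i, mvfderiv I (fun q : M ↦ mvfderiv I f q (e' i q)) p (e' i p) = 0) :
    ∑ i, mvfderiv I f p (leviCivita I M (e i) p (e i p)) =
      ∑ i, mvfderiv I f p (leviCivita I M (e' i) p (e' i p)) := by
  let h : TangentSpace I p → TangentSpace I p →L[ℝ] ℝ := fun u ↦
    TensorialAt.mkHom (hessian I f p u) p (hessian_tensorialAt hf u)
  have hh : ∀ u {Y : Π x : M, TangentSpace I x}, MDiffAt (T% Y) p →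
      h u (Y p) = hessian I f p u Y := fun u Y hY ↦
    TensorialAt.mkHom_apply (hessian_tensorialAt hf u) hY
  -- Tensoriality covers only the argument `Y`; linearity in `u` is read off after fixing an
  -- extension of the second vector.
  let B : TangentSpace I p →ₗ[ℝ] TangentSpace I p →ₗ[ℝ] ℝ :=
    LinearMap.mk₂ ℝ (fun u v ↦ h u v)
      (fun u u' v ↦ by
        simp only [h, TensorialAt.mkHom_apply_eq_extend, hessian, map_add]
        ring)
      (fun c u v ↦ by
        simp only [h, TensorialAt.mkHom_apply_eq_extend, hessian, map_smul, smul_eq_mul]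
        ring)
      (fun u v v' ↦ map_add _ _ _) (fun c u v ↦ map_smul _ _ _)
  have hB := sum_bilin_orthonormal_eq hι B ho hk ho' hk'
  have h1 : ∀ i, B (e i p) (e i p) = - mvfderiv I f p (leviCivita I M (e i) p (e i p)) :=
    fun i ↦ by
      change h (e i p) (e i p) = _
      rw [hh _ (he i), hessian, hd i, zero_sub]
  have h2 : ∀ i, B (e' i p) (e' i p) = - mvfderiv I f p (leviCivita I M (e' i) p (e' i p)) :=
    fun i ↦ by
      change h (e' i p) (e' i p) = _
      rw [hh _ (he' i), hessian, hd' i, zero_sub]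
  simpa only [h1, h2, Finset.sum_neg_distrib, neg_inj] using hB

end Hessian

/-! ### Tangent spaces of hypersurfaces -/

section TangentSpaceOf

variable {n : ℕ} {M : Type*} [TopologicalSpace M] [ChartedSpace (EuclideanSpace ℝ (Fin n)) M]
  {S : Set M} {f : M → ℝ}

/-- The differential of a function that vanishes on `S` vanishes on the tangent space of `S`. -/
theorem mvfderiv_eq_zero_of_mem_tangentSpaceOf {q : M} {v : TangentSpace (𝓡 n) q}
    (hf : MDifferentiableAt (𝓡 n) 𝓘(ℝ, ℝ) f q) (h0 : ∀ᶠ x in 𝓝[S] q, f x = 0)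
    (hv : v ∈ tangentSpaceOf S q) : mvfderiv (𝓡 n) f q v = 0 := by
  suffices h : tangentSpaceOf S q ≤ (mvfderiv (𝓡 n) f q).ker from h hv
  refine Submodule.span_le.2 ?_
  rintro w ⟨γ, hγS, hγ, h⟩
  -- The equation in the tangent bundle holds both the base point and the velocity, so this
  -- substitutes `γ 0` for the point and the derivative of `γ` for the vector.
  cases h
  change mvfderiv (𝓡 n) f (γ 0) (mfderiv 𝓘(ℝ, ℝ) (𝓡 n) γ 0 1) = 0
  have ht : Tendsto γ (𝓝 0) (𝓝[S] (γ 0)) :=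
    tendsto_nhdsWithin_iff.2 ⟨hγ.continuousAt, hγS⟩
  have hz : f ∘ γ =ᶠ[𝓝 0] fun _ ↦ (0 : ℝ) := ht.eventually h0
  have h1 := mfderiv_comp_apply (0 : ℝ) hf hγ (1 : ℝ)
  rw [hz.mfderiv_eq, mfderiv_const] at h1
  exact h1.symm

theorem mfderiv_mem_tangentSpaceOf {S' : Set M} {g : M → M} {y : M} {w : TangentSpace (𝓡 n) y}
    (hg : MDifferentiableAt (𝓡 n) (𝓡 n) g y) (hS : MapsTo g S S')
    (hw : w ∈ tangentSpaceOf S y) :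
    mfderiv (𝓡 n) (𝓡 n) g y w ∈ tangentSpaceOf S' (g y) := by
  suffices h : tangentSpaceOf S y ≤
      (tangentSpaceOf S' (g y)).comap (mfderiv (𝓡 n) (𝓡 n) g y).toLinearMap from h hw
  refine Submodule.span_le.2 ?_
  rintro w ⟨γ, hγS, hγ, h⟩
  cases h
  refine Submodule.subset_span ⟨g ∘ γ, hγS.mono fun t ht ↦ hS ht, hg.comp 0 hγ, ?_⟩
  simp only [tangentMap]
  rw [mfderiv_comp (0 : ℝ) hg hγ]
  rfl

/-- Transports a vector between tangent spaces at propositionally equal points; all of them are the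
same model space by definition. -/
theorem mem_tangentSpaceOf_congr {q q' : M} (h : q = q') (v : EuclideanSpace ℝ (Fin n)) :
    (show TangentSpace (𝓡 n) q from v) ∈ tangentSpaceOf S q ↔
      (show TangentSpace (𝓡 n) q' from v) ∈ tangentSpaceOf S q' := by
  subst h
  rfl

theorem tangentBundle_mk_congr {q q' : M} (h : q = q') {v w : EuclideanSpace ℝ (Fin n)}
    (hv : v = w) :
    (⟨q, v⟩ : TangentBundle (𝓡 n) M) = (⟨q', w⟩ : TangentBundle (𝓡 n) M) := by
  subst h hv
  rfl

variable [IsManifold (𝓡 n) ∞ M]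

omit [IsManifold (𝓡 n) ∞ M] in
-- The pulled-back vector is the image of `V (φ q)` under the differential of `φ.symm`, which also
-- maps `S` into itself.
theorem mpullback_mem_tangentSpaceOf (φ : M ≃ₘ^∞⟮𝓡 n, 𝓡 n⟯ M) (hS : φ '' S = S)
    {V : Π x : M, TangentSpace (𝓡 n) x} {q : M} (h : V (φ q) ∈ tangentSpaceOf S (φ q)) :
    mpullback (𝓡 n) (𝓡 n) φ V q ∈ tangentSpaceOf S q := by
  have hS' : MapsTo φ.symm S S := by
    intro x hx
    rw [← hS] at hx
    obtain ⟨y, hy, rfl⟩ := hx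
    rwa [φ.symm_apply_apply]
  have h1 := mfderiv_mem_tangentSpaceOf (φ.symm.mdifferentiable (by simp) (φ q)) hS' h
  have h2 := mfderiv_comp_apply q (φ.symm.mdifferentiable (by simp) (φ q))
    (φ.mdifferentiable (by simp) q) (mpullback (𝓡 n) (𝓡 n) φ V q)
  have h3 : φ.symm ∘ φ = id := funext φ.symm_apply_apply
  rw [mfderiv_mpullback, h3, mfderiv_id] at h2
  refine (mem_tangentSpaceOf_congr (φ.symm_apply_apply q) _).1 ?_
  rw [← h2] at h1
  exact h1

omit [IsManifold (𝓡 n) ∞ M] in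
theorem contDiffAt_comp_extChartAt_symm {q : M} (hf : ContMDiffAt (𝓡 n) 𝓘(ℝ, ℝ) 1 f q) :
    ContDiffAt ℝ 1 (f ∘ (extChartAt (𝓡 n) q).symm) (extChartAt (𝓡 n) q q) := by
  have h := (contMDiffAt_iff.1 hf).2
  rw [extChartAt_model_space_eq_id, modelWithCornersSelf_coe, range_id, contDiffWithinAt_univ] at h
  exact h

omit [IsManifold (𝓡 n) ∞ M] in
theorem mvfderiv_eq_fderiv {q : M} (hf : MDifferentiableAt (𝓡 n) 𝓘(ℝ, ℝ) f q) :
    mvfderiv (𝓡 n) f q =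
      fderiv ℝ (f ∘ (extChartAt (𝓡 n) q).symm) (extChartAt (𝓡 n) q q) := by
  have h := hf.mvfderiv
  simpa [writtenInExtChartAt] using! h

/-- At a regular point of a level set, the tangent space contains the kernel of the
differential. -/
theorem mem_tangentSpaceOf {q : M} {v : TangentSpace (𝓡 n) q}
    (hf : ContMDiffAt (𝓡 n) 𝓘(ℝ, ℝ) 1 f q) (h0 : mvfderiv (𝓡 n) f q ≠ 0)
    (hS : ∀ᶠ x in 𝓝 q, f x = f q → x ∈ S) (hv : mvfderiv (𝓡 n) f q v = 0) :
    v ∈ tangentSpaceOf S q := by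
  have hd : MDifferentiableAt (𝓡 n) 𝓘(ℝ, ℝ) f q := hf.mdifferentiableAt (by simp)
  rw [mvfderiv_eq_fderiv hd] at h0 hv
  have hF := (contDiffAt_comp_extChartAt_symm hf).hasStrictFDerivAt (by simp)
  obtain ⟨γ, hγ0, hγ, hγF⟩ := exists_hasDerivAt_levelSet hF h0 hv
  have hs : MDifferentiableAt 𝓘(ℝ, EuclideanSpace ℝ (Fin n)) (𝓡 n) (extChartAt (𝓡 n) q).symm
      (γ 0) := by
    rw [hγ0]
    have := mdifferentiableWithinAt_extChartAt_symm (I := 𝓡 n) (mem_extChartAt_target q)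
    simpa [mdifferentiableWithinAt_univ] using this
  have hγm : MDifferentiableAt 𝓘(ℝ, ℝ) 𝓘(ℝ, EuclideanSpace ℝ (Fin n)) γ 0 :=
    hγ.differentiableAt.mdifferentiableAt
  have hq : (extChartAt (𝓡 n) q).symm (γ 0) = q := by rw [hγ0, extChartAt_to_inv]
  refine Submodule.subset_span ⟨(extChartAt (𝓡 n) q).symm ∘ γ, ?_, hs.comp 0 hγm, ?_⟩
  · have ht : Tendsto ((extChartAt (𝓡 n) q).symm ∘ γ) (𝓝 0) (𝓝 q) := by
      have := (hs.comp 0 hγm).continuousAt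
      rwa [ContinuousAt, Function.comp_apply, hq] at this
    filter_upwards [ht.eventually hS, hγF] with t h1 h2
    refine h1 ?_
    simpa using h2
  · refine tangentBundle_mk_congr hq ?_
    have h1 := mfderiv_comp_apply (0 : ℝ) hs hγm (1 : ℝ)
    have h2 : mfderiv 𝓘(ℝ, ℝ) 𝓘(ℝ, EuclideanSpace ℝ (Fin n)) γ 0 (1 : ℝ) = v := by
      rw [mfderiv_eq_fderiv, hγ.hasFDerivAt.fderiv]
      exact one_smul ℝ (show EuclideanSpace ℝ (Fin n) from v)
    have h3 := mfderivWithin_range_extChartAt_symm (I := 𝓡 n) (x := q)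
    rw [modelWithCornersSelf_coe, range_id, mfderivWithin_univ, ← hγ0] at h3
    rw [h2] at h1
    exact h1.trans (congrArg (fun A ↦ A v) h3)

end TangentSpaceOf

/-! ### Regular level sets: differential, tangent spaces and the two sides -/

section DefiningFunction

variable {n : ℕ} {M : Type*} [TopologicalSpace M] [ChartedSpace (EuclideanSpace ℝ (Fin n)) M]
  [IsManifold (𝓡 n) ∞ M] {S : Set M} {f : M → ℝ} {p : M}

/-- If the differential of `f` is differentiable at `p` in the chart at `p`, then so is its
pairing with every vector field that is differentiable at `p`. -/
theorem mdifferentiableAt_mvfderiv_apply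
    (hf : ∀ᶠ x in 𝓝 p, MDifferentiableAt (𝓡 n) 𝓘(ℝ, ℝ) f x)
    (hf2 : DifferentiableAt ℝ (fderiv ℝ (f ∘ (extChartAt (𝓡 n) p).symm)) (extChartAt (𝓡 n) p p))
    {Y : Π x : M, TangentSpace (𝓡 n) x}
    (hY : MDifferentiableAt (𝓡 n) (𝓡 n).tangent
      (fun x : M ↦ (⟨x, Y x⟩ : TangentBundle (𝓡 n) M)) p) :
    MDifferentiableAt (𝓡 n) 𝓘(ℝ, ℝ) (fun q : M ↦ mvfderiv (𝓡 n) f q (Y q)) p := by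
  have h1 : MDifferentiableAt (𝓡 n) 𝓘(ℝ, EuclideanSpace ℝ (Fin n))
      (fun q : M ↦ (trivializationAt (EuclideanSpace ℝ (Fin n)) (TangentSpace (𝓡 n)) p
        (⟨q, Y q⟩ : TangentBundle (𝓡 n) M)).2) p := (mdifferentiableAt_section _ Y).1 hY
  have h2 : MDifferentiableAt (𝓡 n) 𝓘(ℝ, EuclideanSpace ℝ (Fin n) →L[ℝ] ℝ)
      (fun q : M ↦ fderiv ℝ (f ∘ (extChartAt (𝓡 n) p).symm) (extChartAt (𝓡 n) p q)) p :=
    hf2.mdifferentiableAt.comp p (mdifferentiableAt_extChartAt (mem_chart_source _ p))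
  -- Near `p` the pairing is the differential of the chart expression of `f` applied to the
  -- coordinates of `Y`, and both factors are differentiable at `p`.
  refine (h2.clm_apply h1).congr_of_eventuallyEq ?_
  filter_upwards [hf, extChartAt_source_mem_nhds (I := 𝓡 n) p] with q hq hqs
  have hqc : q ∈ (chartAt (EuclideanSpace ℝ (Fin n)) p).source := by rwa [extChartAt_source] at hqs
  have hqb : q ∈ (trivializationAt (EuclideanSpace ℝ (Fin n)) (TangentSpace (𝓡 n)) p).baseSet := by
    simpa using hqc
  have h3 : (trivializationAt (EuclideanSpace ℝ (Fin n)) (TangentSpace (𝓡 n)) p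
      (⟨q, Y q⟩ : TangentBundle (𝓡 n) M)).2 =
      mfderiv (𝓡 n) 𝓘(ℝ, EuclideanSpace ℝ (Fin n)) (extChartAt (𝓡 n) p) q (Y q) := by
    have h : (trivializationAt (EuclideanSpace ℝ (Fin n)) (TangentSpace (𝓡 n)) p).continuousLinearMapAt
        ℝ q (Y q) = (trivializationAt (EuclideanSpace ℝ (Fin n)) (TangentSpace (𝓡 n)) p
          (⟨q, Y q⟩ : TangentBundle (𝓡 n) M)).2 := by
      rw [Trivialization.continuousLinearMapAt_apply, Trivialization.linearMapAt_apply, if_pos hqb]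
    exact h.symm.trans (congrArg (fun A ↦ A (Y q))
      (TangentBundle.continuousLinearMapAt_trivializationAt (I := 𝓡 n) hqc))
  have hsymm : MDifferentiableAt 𝓘(ℝ, EuclideanSpace ℝ (Fin n)) (𝓡 n)
      (extChartAt (𝓡 n) p).symm (extChartAt (𝓡 n) p q) := by
    have := mdifferentiableWithinAt_extChartAt_symm (I := 𝓡 n)
      ((extChartAt (𝓡 n) p).map_source hqs)
    simpa [mdifferentiableWithinAt_univ] using this
  have hq' : MDifferentiableAt (𝓡 n) 𝓘(ℝ, ℝ) f
      ((extChartAt (𝓡 n) p).symm (extChartAt (𝓡 n) p q)) := by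
    rwa [(extChartAt (𝓡 n) p).left_inv hqs]
  have hF : MDifferentiableAt 𝓘(ℝ, EuclideanSpace ℝ (Fin n)) 𝓘(ℝ, ℝ)
      (f ∘ (extChartAt (𝓡 n) p).symm) (extChartAt (𝓡 n) p q) := hq'.comp _ hsymm
  have h4 : f =ᶠ[𝓝 q] (f ∘ (extChartAt (𝓡 n) p).symm) ∘ extChartAt (𝓡 n) p := by
    filter_upwards [(isOpen_extChartAt_source (I := 𝓡 n) p).mem_nhds hqs] with x hx
    simp only [Function.comp_apply]
    rw [(extChartAt (𝓡 n) p).left_inv hx]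
  have h5 := mfderiv_comp_apply q hF (mdifferentiableAt_extChartAt (I := 𝓡 n) hqc) (Y q)
  rw [← h4.mfderiv_eq, mfderiv_eq_fderiv] at h5
  rw [h3]
  exact h5

/-- The tangent space of a regular level set is the kernel of the differential. -/
theorem eventually_mem_tangentSpaceOf_iff
    (hf : ∀ᶠ x in 𝓝 p, ContMDiffAt (𝓡 n) 𝓘(ℝ, ℝ) 1 f x)
    (hS : ∀ᶠ x in 𝓝 p, x ∈ S ↔ f x = 0) (h0 : ∀ᶠ x in 𝓝 p, mvfderiv (𝓡 n) f x ≠ 0) :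
    ∀ᶠ q in 𝓝[S] p, ∀ v : TangentSpace (𝓡 n) q,
      v ∈ tangentSpaceOf S q ↔ mvfderiv (𝓡 n) f q v = 0 := by
  filter_upwards [self_mem_nhdsWithin, mem_nhdsWithin_of_mem_nhds hf,
    -- The description of `S` is needed on a whole neighbourhood of `q`, because the tangent space
    -- at `q` is defined by curves.
    mem_nhdsWithin_of_mem_nhds (eventually_eventually_nhds.2 hS),
    mem_nhdsWithin_of_mem_nhds h0] with q hqS hq hqn hq0 v
  have hfq : f q = 0 := (hqn.self_of_nhds).1 hqS
  refine ⟨mvfderiv_eq_zero_of_mem_tangentSpaceOf (hq.mdifferentiableAt (by simp)) ?_,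
    mem_tangentSpaceOf hq hq0 ?_⟩
  · filter_upwards [self_mem_nhdsWithin, mem_nhdsWithin_of_mem_nhds hqn] with x hx hxn
    exact hxn.1 hx
  · filter_upwards [hqn] with x hx h
    exact hx.2 (h.trans hfq)

omit [IsManifold (𝓡 n) ∞ M] in
/-- Near a regular zero of `f`, the positive side of the zero set is connected. -/
theorem exists_isPreconnected_pos_manifold {N : Set M}
    (hf : ContMDiffAt (𝓡 n) 𝓘(ℝ, ℝ) 1 f p) (h0 : mvfderiv (𝓡 n) f p ≠ 0)
    (hN : N ∈ 𝓝 p) :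
    ∃ W : Set M, IsPreconnected W ∧ W ⊆ N ∧ (∀ x ∈ W, 0 < f x) ∧
      ∀ᶠ x in 𝓝 p, 0 < f x → x ∈ W := by
  rw [mvfderiv_eq_fderiv (hf.mdifferentiableAt (by simp))] at h0
  have hF := (contDiffAt_comp_extChartAt_symm hf).hasStrictFDerivAt (by simp)
  have hN' : (extChartAt (𝓡 n) p).target ∩ (extChartAt (𝓡 n) p).symm ⁻¹' N ∈
      𝓝 (extChartAt (𝓡 n) p p) := by
    refine inter_mem (extChartAt_target_mem_nhds p) ?_
    refine (continuousAt_extChartAt_symm p).preimage_mem_nhds ?_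
    rwa [extChartAt_to_inv]
  obtain ⟨W, hW, hWN, hWpos, hW'⟩ := exists_isPreconnected_pos hF h0 hN'
  refine ⟨(extChartAt (𝓡 n) p).symm '' W, ?_, ?_, ?_, ?_⟩
  · exact hW.image _ ((continuousOn_extChartAt_symm p).mono fun x hx ↦ (hWN hx).1)
  · rintro _ ⟨x, hx, rfl⟩
    exact (hWN hx).2
  · rintro _ ⟨x, hx, rfl⟩
    exact hWpos x hx
  · filter_upwards [(continuousAt_extChartAt (I := 𝓡 n) p).eventually hW',
      extChartAt_source_mem_nhds (I := 𝓡 n) p] with x hx hxs hpos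
    have hl := (extChartAt (𝓡 n) p).left_inv hxs
    exact ⟨extChartAt (𝓡 n) p x, hx (by simpa only [Function.comp_apply, hl] using hpos), hl⟩

omit [IsManifold (𝓡 n) ∞ M] in
/-- A diffeomorphism that fixes `p` and swaps the two domains does not map the side of `S` into
which `N` points to itself. -/
theorem mvfderiv_mfderiv_nonpos_of_swap {D₁ D₂ : Set M} (hD : Divides S D₁ D₂)
    (φ : M ≃ₘ^∞⟮𝓡 n, 𝓡 n⟯ M) (hφp : φ p = p) (h12 : φ '' D₁ = D₂) (h21 : φ '' D₂ = D₁)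
    (hf : ContMDiffAt (𝓡 n) 𝓘(ℝ, ℝ) 1 f p) (hfp : f p = 0)
    (hS : ∀ᶠ x in 𝓝 p, x ∈ S ↔ f x = 0) {v : EuclideanSpace ℝ (Fin n)}
    (hv : 0 < mvfderiv (𝓡 n) f p v) :
    mvfderiv (𝓡 n) (f ∘ φ) p v ≤ 0 := by
  by_contra! hc
  have h0 : mvfderiv (𝓡 n) f p ≠ 0 := fun h ↦ hv.ne' (by rw [h]; rfl)
  obtain ⟨W, hW, hWS, hWpos, hW'⟩ := exists_isPreconnected_pos_manifold hf h0 hS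
  have hcover : W ⊆ D₁ ∪ D₂ := fun x hx ↦ by
    rw [hD.union_eq]
    exact fun hxS ↦ (hWpos x hx).ne' ((hWS hx).1 hxS)
  have hfm : MDifferentiableAt (𝓡 n) 𝓘(ℝ, ℝ) f p := hf.mdifferentiableAt (by simp)
  have hφm : MDifferentiableAt (𝓡 n) (𝓡 n) φ p := φ.mdifferentiable (by simp) p
  have hfm' : MDifferentiableAt (𝓡 n) 𝓘(ℝ, ℝ) f (φ p) := by rwa [hφp]
  let e := extChartAt (𝓡 n) p
  -- A straight line in the chart with velocity `v`: for small `t > 0` both `f` and `f ∘ φ` are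
  -- positive along it.
  let c : ℝ → EuclideanSpace ℝ (Fin n) := fun t ↦ e p + t • v
  have hcd : HasDerivAt c v 0 := by
    have h := ((hasDerivAt_id (0 : ℝ)).smul_const v).const_add (e p)
    rwa [one_smul] at h
  have hc0 : c 0 = e p := by simp [c]
  have hγ : Tendsto (e.symm ∘ c) (𝓝 0) (𝓝 p) := by
    have h := continuousAt_extChartAt_symm (I := 𝓡 n) p
    rw [ContinuousAt, extChartAt_to_inv] at h
    refine h.comp ?_
    rw [← hc0]
    exact hcd.continuousAt
  have key : ∀ g : M → ℝ, MDifferentiableAt (𝓡 n) 𝓘(ℝ, ℝ) g p → g p = 0 →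
      0 < mvfderiv (𝓡 n) g p v → ∀ᶠ t in 𝓝[>] (0 : ℝ), 0 < g (e.symm (c t)) := by
    intro g hg hgp hpos
    rw [mvfderiv_eq_fderiv hg] at hpos
    have hG : DifferentiableAt ℝ (g ∘ e.symm) (e p) := by
      by_contra h
      rw [fderiv_zero_of_not_differentiableAt h] at hpos
      exact lt_irrefl _ hpos
    rw [← hc0] at hG hpos
    have hd : HasDerivAt (fun t ↦ g (e.symm (c t))) _ 0 := hG.hasFDerivAt.comp_hasDerivAt (0 : ℝ) hcd
    have hz : g (e.symm (c 0)) = 0 := by rw [hc0, extChartAt_to_inv, hgp]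
    have h := eventually_nhdsWithin_sign_eq_of_deriv_pos (f := fun t ↦ g (e.symm (c t)))
      (x₀ := (0 : ℝ)) (by rw [hd.deriv]; exact hpos) hz
    filter_upwards [nhdsWithin_le_nhds h, self_mem_nhdsWithin] with t ht ht0
    rw [sub_zero] at ht
    exact sign_eq_one_iff.1 (ht.trans (sign_pos ht0))
  have h1 := key f hfm hfp hv
  have h2 := key (f ∘ φ) (hfm'.comp p hφm) (by simp [hφp, hfp]) hc
  have hφt : Tendsto φ (𝓝 p) (𝓝 p) := by
    have := φ.continuous.tendsto p
    rwa [hφp] at this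
  have h3 := (hγ.mono_left nhdsWithin_le_nhds : Tendsto (e.symm ∘ c) (𝓝[>] 0) (𝓝 p)).eventually hW'
  have h4 := (hφt.comp (hγ.mono_left nhdsWithin_le_nhds :
    Tendsto (e.symm ∘ c) (𝓝[>] 0) (𝓝 p))).eventually hW'
  obtain ⟨t, h1, h2, h3, h4⟩ := (h1.and (h2.and (h3.and h4))).exists
  have ha := h3 h1
  have hb := h4 h2
  -- The connected set `W` lies in a single domain and contains both the point and its image,
  -- whereas `φ` moves that domain onto the other.
  rcases hW.subset_or_subset hD.isOpen₁ hD.isOpen₂ hD.disjoint hcover with h | h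
  · exact hD.disjoint.notMem_of_mem_left (h hb) (h12 ▸ mem_image_of_mem φ (h ha))
  · exact hD.disjoint.notMem_of_mem_left (h21 ▸ mem_image_of_mem φ (h ha)) (h hb)

end DefiningFunction

/-! ### Tangent frames, the reflection argument and minimality -/

section MeanCurvature

variable {n : ℕ} {M : Type*} [TopologicalSpace M] [ChartedSpace (EuclideanSpace ℝ (Fin n)) M]

/-- Rank-nullity. A nonzero differential forces `1 ≤ n`, so the truncated subtraction loses nothing.
-/
theorem finrank_ker_mvfderiv {f : M → ℝ} {p : M} (h0 : mvfderiv (𝓡 n) f p ≠ 0) :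
    Module.finrank ℝ (mvfderiv (𝓡 n) f p).ker = n - 1 := by
  have h1 := Module.Dual.finrank_ker_add_one_of_ne_zero
    (f := (mvfderiv (𝓡 n) f p).toLinearMap) fun h ↦ h0 (ContinuousLinearMap.coe_injective h)
  have h2 : Module.finrank ℝ (TangentSpace (𝓡 n) p) = n := finrank_euclideanSpace_fin (𝕜 := ℝ)
  change Module.finrank ℝ (mvfderiv (𝓡 n) f p).ker + 1 = _ at h1
  omega

variable [IsManifold (𝓡 n) ∞ M] [RiemannianBundle (fun x : M ↦ TangentSpace (𝓡 n) x)]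

/-- A family of vector fields that are differentiable at `p` and tangent to `S` along `S` near `p`,
and that are orthonormal at `p`. -/
structure IsTangentFrameAt (S : Set M) (p : M)
    (e : Fin (n - 1) → Π x : M, TangentSpace (𝓡 n) x) : Prop where
  mdifferentiableAt : ∀ i, MDifferentiableAt (𝓡 n) (𝓡 n).tangent
    (fun x : M ↦ (⟨x, e i x⟩ : TangentBundle (𝓡 n) M)) p
  tangent : ∀ i, ∀ᶠ q in 𝓝[S] p, e i q ∈ tangentSpaceOf S q
  orthonormal : Orthonormal ℝ fun i ↦ e i p

/-- Isometries that preserve `S` pull tangent frames back to tangent frames. -/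
theorem IsTangentFrameAt.pullback {S : Set M} {p : M}
    {e : Fin (n - 1) → Π x : M, TangentSpace (𝓡 n) x} (he : IsTangentFrameAt S p e)
    {φ : M ≃ₘ^∞⟮𝓡 n, 𝓡 n⟯ M} (hφ : IsRiemannianIsometry φ) (hφp : φ p = p) (hS : φ '' S = S) :
    IsTangentFrameAt S p fun i ↦ mpullback (𝓡 n) (𝓡 n) φ (e i) where
  mdifferentiableAt i := mdifferentiableAt_mpullback φ (by rw [hφp]; exact he.mdifferentiableAt i)
  tangent i := by
    have ht : Tendsto φ (𝓝[S] p) (𝓝[S] p) := by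
      have h := φ.continuous.continuousWithinAt.tendsto_nhdsWithin (s := S) (x := p)
        (fun x hx ↦ hS ▸ mem_image_of_mem φ hx : MapsTo φ S S)
      rwa [hφp] at h
    filter_upwards [ht.eventually (he.tangent i)] with q hq
    exact mpullback_mem_tangentSpaceOf φ hS hq
  orthonormal := by
    have h := he.orthonormal
    rw [orthonormal_iff_ite] at h ⊢
    intro i j
    rw [inner_mpullback hφ, hφp, h]

variable [IsContMDiffRiemannianBundle (𝓡 n) ∞ (EuclideanSpace ℝ (Fin n))
    (fun x : M ↦ TangentSpace (𝓡 n) x)] {S : Set M} {f : M → ℝ} {p : M}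

omit [IsContMDiffRiemannianBundle (𝓡 n) ∞ (EuclideanSpace ℝ (Fin n))
    (fun x : M ↦ TangentSpace (𝓡 n) x)] in
/-- A hypersurface has tangent frames where a defining function is twice differentiable. -/
theorem exists_isTangentFrameAt
    (hd : ∀ Y : Π x : M, TangentSpace (𝓡 n) x, MDifferentiableAt (𝓡 n) (𝓡 n).tangent
      (fun x : M ↦ (⟨x, Y x⟩ : TangentBundle (𝓡 n) M)) p →
      MDifferentiableAt (𝓡 n) 𝓘(ℝ, ℝ) (fun q : M ↦ mvfderiv (𝓡 n) f q (Y q)) p)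
    (h0 : mvfderiv (𝓡 n) f p ≠ 0)
    (hT : ∀ᶠ q in 𝓝[S] p, ∀ v : TangentSpace (𝓡 n) q,
      v ∈ tangentSpaceOf S q ↔ mvfderiv (𝓡 n) f q v = 0) :
    ∃ e : Fin (n - 1) → Π x : M, TangentSpace (𝓡 n) x, IsTangentFrameAt S p e := by
  obtain ⟨u, hu⟩ : ∃ u, mvfderiv (𝓡 n) f p u = 1 :=
    LinearMap.surjective (f := (mvfderiv (𝓡 n) f p).toLinearMap)
      (fun h ↦ h0 (ContinuousLinearMap.coe_injective h)) 1
  have hext := fun w : TangentSpace (𝓡 n) p ↦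
    FiberBundle.mdifferentiableAt_extend (𝓡 n) (EuclideanSpace ℝ (Fin n)) w
  let X : TangentSpace (𝓡 n) p → Π x : M, TangentSpace (𝓡 n) x :=
    fun w ↦ FiberBundle.extend (EuclideanSpace ℝ (Fin n)) w
  have hX : ∀ w, X w p = w := fun w ↦ by simp [X]
  let b : OrthonormalBasis (Fin (n - 1)) ℝ (mvfderiv (𝓡 n) f p).ker :=
    (stdOrthonormalBasis ℝ _).reindex (finCongr (finrank_ker_mvfderiv h0))
  -- The combination `(X_u f) X_b - (X_b f) X_u` is annihilated by `df` at every point, and equals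
  -- `b` at `p` because `df_p u = 1` and `df_p b = 0`.
  let e : Fin (n - 1) → Π x : M, TangentSpace (𝓡 n) x := fun i ↦
    (fun q ↦ mvfderiv (𝓡 n) f q (X u q)) • X (b i) -
      (fun q ↦ mvfderiv (𝓡 n) f q (X (b i) q)) • X u
  have hep : ∀ i, e i p = b i := fun i ↦ by
    have hb : mvfderiv (𝓡 n) f p (b i) = 0 := (b i).2
    simp only [e, Pi.sub_apply, Pi.smul_apply', hX, hu, hb, one_smul, zero_smul, sub_zero]
  refine ⟨e, fun i ↦ ?_, fun i ↦ ?_, ?_⟩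
  · exact mdifferentiableAt_sub_section ((hd _ (hext u)).smul_section (hext (b i)))
      ((hd _ (hext (b i))).smul_section (hext u))
  · filter_upwards [hT] with q hq
    rw [hq]
    simp only [e, Pi.sub_apply, Pi.smul_apply', map_sub, map_smul, smul_eq_mul]
    ring
  · simp only [hep]
    exact b.orthonormal.comp_linearIsometry (Submodule.subtypeₗᵢ _)

/-- `∑ i, (∇_{e i} (e i)) f` does not depend on the tangent frame `e`. -/
theorem IsTangentFrameAt.sum_mvfderiv_eq (hp : p ∈ S)
    (hd : ∀ Y : Π x : M, TangentSpace (𝓡 n) x, MDifferentiableAt (𝓡 n) (𝓡 n).tangent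
      (fun x : M ↦ (⟨x, Y x⟩ : TangentBundle (𝓡 n) M)) p →
      MDifferentiableAt (𝓡 n) 𝓘(ℝ, ℝ) (fun q : M ↦ mvfderiv (𝓡 n) f q (Y q)) p)
    (h0 : mvfderiv (𝓡 n) f p ≠ 0)
    (hT : ∀ᶠ q in 𝓝[S] p, ∀ v : TangentSpace (𝓡 n) q,
      v ∈ tangentSpaceOf S q ↔ mvfderiv (𝓡 n) f q v = 0)
    {e e' : Fin (n - 1) → Π x : M, TangentSpace (𝓡 n) x}
    (he : IsTangentFrameAt S p e) (he' : IsTangentFrameAt S p e') :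
    ∑ i, mvfderiv (𝓡 n) f p (leviCivita (𝓡 n) M (e i) p (e i p)) =
      ∑ i, mvfderiv (𝓡 n) f p (leviCivita (𝓡 n) M (e' i) p (e' i p)) := by
  have hmem : ∀ {a : Fin (n - 1) → Π x : M, TangentSpace (𝓡 n) x}, IsTangentFrameAt S p a →
      ∀ i, a i p ∈ tangentSpaceOf S p := fun ha i ↦ (ha.tangent i).self_of_nhdsWithin hp
  have hk : ∀ {a : Fin (n - 1) → Π x : M, TangentSpace (𝓡 n) x}, IsTangentFrameAt S p a →
      ∀ i, mvfderiv (𝓡 n) f p (a i p) = 0 := fun ha i ↦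
    (hT.self_of_nhdsWithin hp _).1 (hmem ha i)
  have hs : ∀ {a : Fin (n - 1) → Π x : M, TangentSpace (𝓡 n) x}, IsTangentFrameAt S p a →
      -- The function `(a i) f` vanishes along `S` near `p`, so its differential kills the tangent
      -- vector `a i p`.
      ∀ i, mvfderiv (𝓡 n) (fun q : M ↦ mvfderiv (𝓡 n) f q (a i q)) p (a i p) = 0 := fun ha i ↦ by
    refine mvfderiv_eq_zero_of_mem_tangentSpaceOf (hd _ (ha.mdifferentiableAt i)) ?_ (hmem ha i)
    filter_upwards [hT, ha.tangent i] with q hq hq'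
    exact (hq _).1 hq'
  exact sum_mvfderiv_leviCivita_eq hd (by rw [finrank_ker_mvfderiv h0, Fintype.card_fin])
    he.mdifferentiableAt he'.mdifferentiableAt he.orthonormal he'.orthonormal (hk he) (hk he')
    (hs he) (hs he')

/-- If an isometry fixes `p`, preserves `S` and reverses the sign of the normal direction, then
`∑ i, (∇_{e i} (e i)) f` vanishes at `p`. -/
theorem IsTangentFrameAt.sum_mvfderiv_eq_zero (hp : p ∈ S)
    (hf : MDifferentiableAt (𝓡 n) 𝓘(ℝ, ℝ) f p) (hfS : ∀ᶠ x in 𝓝[S] p, f x = 0)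
    (hd : ∀ Y : Π x : M, TangentSpace (𝓡 n) x, MDifferentiableAt (𝓡 n) (𝓡 n).tangent
      (fun x : M ↦ (⟨x, Y x⟩ : TangentBundle (𝓡 n) M)) p →
      MDifferentiableAt (𝓡 n) 𝓘(ℝ, ℝ) (fun q : M ↦ mvfderiv (𝓡 n) f q (Y q)) p)
    (h0 : mvfderiv (𝓡 n) f p ≠ 0)
    (hT : ∀ᶠ q in 𝓝[S] p, ∀ v : TangentSpace (𝓡 n) q,
      v ∈ tangentSpaceOf S q ↔ mvfderiv (𝓡 n) f q v = 0)
    {φ : M ≃ₘ^∞⟮𝓡 n, 𝓡 n⟯ M} (hφ : IsRiemannianIsometry φ) (hφp : φ p = p) (hS : φ '' S = S)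
    (hneg : ∀ v, 0 < mvfderiv (𝓡 n) f p v → mvfderiv (𝓡 n) (f ∘ φ) p v ≤ 0)
    {e : Fin (n - 1) → Π x : M, TangentSpace (𝓡 n) x} (he : IsTangentFrameAt S p e) :
    ∑ i, mvfderiv (𝓡 n) f p (leviCivita (𝓡 n) M (e i) p (e i p)) = 0 := by
  obtain ⟨u, hu⟩ : ∃ u, mvfderiv (𝓡 n) f p u = 1 :=
    LinearMap.surjective (f := (mvfderiv (𝓡 n) f p).toLinearMap)
      (fun h ↦ h0 (ContinuousLinearMap.coe_injective h)) 1
  set c := mvfderiv (𝓡 n) (f ∘ φ) p u with hc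
  have hc0 : c ≤ 0 := hneg u (by rw [hu]; exact one_pos)
  have hf' : MDifferentiableAt (𝓡 n) 𝓘(ℝ, ℝ) f (φ p) := by rwa [hφp]
  have hφm : MDifferentiableAt (𝓡 n) (𝓡 n) φ p := φ.mdifferentiable (by simp) p
  have hmaps : MapsTo φ S S := fun x hx ↦ hS ▸ mem_image_of_mem φ hx
  have ht : Tendsto φ (𝓝[S] p) (𝓝[S] p) := by
    have h := φ.continuous.continuousWithinAt.tendsto_nhdsWithin (x := p) hmaps
    rwa [hφp] at h
  have hker : ∀ v, mvfderiv (𝓡 n) f p v = 0 → mvfderiv (𝓡 n) (f ∘ φ) p v = 0 := fun v hv ↦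
    mvfderiv_eq_zero_of_mem_tangentSpaceOf (hf'.comp p hφm) (ht.eventually hfS)
      ((hT.self_of_nhdsWithin hp v).2 hv)
  -- Both differentials vanish on `ker df_p`, so they are proportional; evaluating at `u`, where
  -- `df_p u = 1`, identifies the factor as `c`.
  have hprop : ∀ v, mvfderiv (𝓡 n) (f ∘ φ) p v = c * mvfderiv (𝓡 n) f p v := fun v ↦ by
    have h := hker (v - mvfderiv (𝓡 n) f p v • u) (by simp [hu])
    rw [map_sub, map_smul, smul_eq_mul, ← hc] at h
    linarith
  have hframe := he.pullback hφ hφp hS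
  have h1 : ∀ i, mvfderiv (𝓡 n) f p (leviCivita (𝓡 n) M (e i) p (e i p)) =
      c * mvfderiv (𝓡 n) f p (leviCivita (𝓡 n) M (mpullback (𝓡 n) (𝓡 n) φ (e i)) p
        (mpullback (𝓡 n) (𝓡 n) φ (e i) p)) := fun i ↦ by
    have hm := he.mdifferentiableAt i
    rw [← hφp] at hm
    have h := mfderiv_leviCivita_mpullback hφ hm hm
    rw [← hprop, mvfderiv_comp_apply p hf' hφm, h, hφp]
  have h2 := he.sum_mvfderiv_eq hp hd h0 hT hframe
  have h3 : ∑ i, mvfderiv (𝓡 n) f p (leviCivita (𝓡 n) M (e i) p (e i p)) =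
      c * ∑ i, mvfderiv (𝓡 n) f p (leviCivita (𝓡 n) M (e i) p (e i p)) := by
    conv_rhs => rw [h2]
    rw [Finset.mul_sum]
    exact Finset.sum_congr rfl fun i _ ↦ h1 i
  have h4 : (1 - c) * ∑ i, mvfderiv (𝓡 n) f p (leviCivita (𝓡 n) M (e i) p (e i p)) = 0 := by
    linarith
  -- Since `c ≤ 0`, the factor `1 - c` is at least `1`.
  exact (mul_eq_zero.1 h4).resolve_left (by linarith)

/-- A hypersurface is minimal at `p` if `∑ i, (∇_{e i} (e i)) f` vanishes for all tangent
frames. -/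
theorem isMinimalAt_of_sum_eq_zero
    (hT : ∀ v : TangentSpace (𝓡 n) p, v ∈ tangentSpaceOf S p ↔ mvfderiv (𝓡 n) f p v = 0)
    (hex : ∃ e : Fin (n - 1) → Π x : M, TangentSpace (𝓡 n) x, IsTangentFrameAt S p e)
    (hsum : ∀ e : Fin (n - 1) → Π x : M, TangentSpace (𝓡 n) x, IsTangentFrameAt S p e →
      ∑ i, mvfderiv (𝓡 n) f p (leviCivita (𝓡 n) M (e i) p (e i p)) = 0) :
    IsMinimalAt n S p := by
  intro H
  constructor
  · rintro ⟨e, h1, h2, h3, h4, h5⟩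
    have h := hsum e ⟨h1, h2, h3⟩
    -- The sum itself is tangent, hence so is `H`; being also orthogonal to the tangent space, `H`
    -- is zero.
    rw [hT, map_sub, map_sum, h, zero_sub, neg_eq_zero, ← hT] at h4
    exact inner_self_eq_zero.1 (h5 H h4)
  · rintro rfl
    obtain ⟨e, he⟩ := hex
    refine ⟨e, he.mdifferentiableAt, he.tangent, he.orthonormal, ?_, fun v _ ↦ inner_zero_left v⟩
    rw [hT, sub_zero, map_sum, hsum e he]

end MeanCurvature

end Riemannian

end

theorem mainTheorem2 {n : ℕ} {M : Type*} [TopologicalSpace M] [T2Space M]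
    [SecondCountableTopology M] [ChartedSpace (EuclideanSpace ℝ (Fin n)) M]
    [IsManifold (𝓡 n) ∞ M] [RiemannianBundle (fun x : M ↦ TangentSpace (𝓡 n) x)]
    [IsContMDiffRiemannianBundle (𝓡 n) ∞ (EuclideanSpace ℝ (Fin n))
      (fun x : M ↦ TangentSpace (𝓡 n) x)]
    (S : Set M) (hS : Riemannian.IsHelicoidal n S) (p : M) (hp : p ∈ S)
    (hreg : Riemannian.IsTwiceDifferentiableHypersurfaceAt (n := n) S p) :
    Riemannian.IsMinimalAt n S p := by
  obtain ⟨D₁, D₂, hD, hiso⟩ := hS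
  obtain ⟨φ, hφ, hφp, hφS, h12, h21⟩ := hiso p hp
  obtain ⟨U, f, hU, hpU, hSU, hfp, hfU, hf0, hf2⟩ := hreg
  have hC : ∀ᶠ x in 𝓝 p, ContMDiffAt (𝓡 n) 𝓘(ℝ, ℝ) 1 f x := by
    filter_upwards [hU.mem_nhds hpU] with x hx
    exact hfU.contMDiffAt (hU.mem_nhds hx)
  have hSf : ∀ᶠ x in 𝓝 p, x ∈ S ↔ f x = 0 := by
    filter_upwards [hU.mem_nhds hpU] with x hx
    have h : x ∈ S ∩ U ↔ x ∈ {x ∈ U | f x = 0} := by rw [hSU]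
    simpa [hx] using h
  have hmd : ∀ᶠ x in 𝓝 p, MDifferentiableAt (𝓡 n) 𝓘(ℝ, ℝ) f x :=
    hC.mono fun x hx ↦ hx.mdifferentiableAt (by simp)
  have h0 : mvfderiv (𝓡 n) f p ≠ 0 := hf0
  have hd := fun (Y : Π x : M, TangentSpace (𝓡 n) x) hY ↦
    Riemannian.mdifferentiableAt_mvfderiv_apply (Y := Y) hmd hf2 hY
  -- Pairing `df` with one field that is differentiable at `p` gives a function continuous at `p`
  -- and nonzero there, hence nonzero nearby.
  have hne : ∀ᶠ x in 𝓝 p, mvfderiv (𝓡 n) f x ≠ 0 := by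
    obtain ⟨u, hu⟩ : ∃ u, mvfderiv (𝓡 n) f p u ≠ 0 := by
      by_contra! h
      exact h0 (ContinuousLinearMap.ext h)
    have hX := FiberBundle.mdifferentiableAt_extend (𝓡 n) (EuclideanSpace ℝ (Fin n)) u
    have h := (hd _ hX).continuousAt.eventually_ne (y := 0) (by simpa using hu)
    filter_upwards [h] with x hx h'
    exact hx (by rw [h']; rfl)
  have hT := Riemannian.eventually_mem_tangentSpaceOf_iff hC hSf hne
  have hfS : ∀ᶠ x in 𝓝[S] p, f x = 0 := by
    filter_upwards [self_mem_nhdsWithin, mem_nhdsWithin_of_mem_nhds hSf] with x hx hx'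
    exact hx'.1 hx
  exact Riemannian.isMinimalAt_of_sum_eq_zero (hT.self_of_nhdsWithin hp)
    (Riemannian.exists_isTangentFrameAt hd h0 hT) fun e he ↦
      he.sum_mvfderiv_eq_zero hp hmd.self_of_nhds hfS hd h0 hT hφ hφp hφS fun v hv ↦
        Riemannian.mvfderiv_mfderiv_nonpos_of_swap hD φ hφp h12 h21 hC.self_of_nhds hfp hSf hv
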